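/- A \emph{computable metric space} is a metric space $(\mathbf X,d)$ with a designated dense sequence $(a_n)_{n\in\mathbb N}$ such that the real double sequence $d(a_i,a_j)$ is computable; a point $x$ is represented by the sequences $p\in\mathbb N^{\mathbb N}$ with $d(a_{p(n)},x)<2^{-n}$ for all $n$. A \emph{computable Polish space} is a complete computable metric space. A represented space $\mathbf X$ is \emph{computably compact} if universal quantification over $\mathbf X$ preserves computable open predicates, i.e. for every represented space $\mathbf Y$ and every computable open $U\subseteq\mathbf Y\times\mathbf X$ the set $\{y\in\mathbf Y \mid \forall x\in\mathbf X\ (y,x)\in U\}$ is computable open in $\mathbf Y$; here a subset is computable open if membership in it is semidecidable given a name of the point. \textbf{Theorem.} The following are equivalent for a computable Polish space $\mathbf X$: \begin{enumerate} \item $\mathbf X$ is computably compact. \item There are computable sequences $(\varepsilon_i)_{i\in\mathbb N}$ of positive rational numbers and $(s_i)_{i\in\mathbb N}$ of natural numbers such that $\lim_{i\to\infty}\varepsilon_i=0$ and, for every $i$, \[ s_i=\sup\{m\in\mathbb N \mid \exists x_1,\ldots,x_m\in\mathbf X\ \forall j,k\le m,\ j\neq k\ \Rightarrow\ d(x_j,x_k)>\varepsilon_i\}.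 \] \end{enumerate} -/

import Mathlib

open Filter Topology

/-- A representation of a set `X`: a partial surjection from Baire space `ℕ → ℕ` onto `X`, given by
its graph. `IsName p x` says that the infinite sequence `p` encodes the point `x`. A set together
with a representation is a represented space. -/
structure RepresentedSpace (X : Type*) where
  IsName : (ℕ → ℕ) → X → Prop
  unique : ∀ {p : ℕ → ℕ} {x y : X}, IsName p x → IsName p y → x = y
  exists_name : ∀ x : X, ∃ p : ℕ → ℕ, IsName p x

namespace RepresentedSpace

/-- The product of two represented spaces: a name of `(x, y)` is a sequence of pairs whose first
components form a name of `x` and whose second components form a name of `y`. -/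
def prod {X Y : Type*} (ρ : RepresentedSpace X) (σ : RepresentedSpace Y) :
    RepresentedSpace (X × Y) where
  IsName r z := ρ.IsName (fun n => (r n).unpair.1) z.1 ∧ σ.IsName (fun n => (r n).unpair.2) z.2
  unique h h' := Prod.ext (ρ.unique h.1 h'.1) (σ.unique h.2 h'.2)
  exists_name z := by
    obtain ⟨p, hp⟩ := ρ.exists_name z.1
    obtain ⟨q, hq⟩ := σ.exists_name z.2
    exact ⟨fun n => Nat.pair (p n) (q n), by simpa using hp, by simpa using hq⟩

/-- `U` is a computable open subset of the represented space: membership in `U` is semidecidable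
from names. An algorithm that reads the name `p` of `x` halts, if at all, after having read a finite
prefix of `p`; the set `W` collects the prefixes on which it halts. -/
def ComputablyOpen {X : Type*} (ρ : RepresentedSpace X) (U : Set X) : Prop :=
  ∃ W : List ℕ → Prop, REPred W ∧
    ∀ (p : ℕ → ℕ) (x : X), ρ.IsName p x → (x ∈ U ↔ ∃ k : ℕ, W ((List.range k).map p))

/-- A represented space `X` is computably compact if universal quantification over `X` preserves
computable open predicates: for every represented space `Y` and every computable open
`U ⊆ Y × X`, the set of all `y` with `(y, x) ∈ U` for all `x` is computable open in `Y`.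
(As `Y` is an image of a subset of Baire space, letting it range over `Type` is no restriction.) -/
def ComputablyCompact {X : Type*} (ρ : RepresentedSpace X) : Prop :=
  ∀ (Y : Type) (σ : RepresentedSpace Y) (U : Set (Y × X)),
    (σ.prod ρ).ComputablyOpen U → σ.ComputablyOpen {y : Y | ∀ x : X, (y, x) ∈ U}

end RepresentedSpace

/-- A family of rational numbers is computable if sign, numerator and denominator are computable. -/
def ComputableRat {α : Type*} [Primcodable α] (r : α → ℚ) : Prop :=
  ∃ s a b : α → ℕ, Computable s ∧ Computable a ∧ Computable b ∧
    ∀ i, b i ≠ 0 ∧ r i = (-1) ^ s i * (a i : ℚ) / (b i : ℚ)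

/-- A family of real numbers is computable (uniformly in the index) if rational approximations to
within `2 ^ (-n)` are computable from the index and `n`. -/
def ComputableReal {α : Type*} [Primcodable α] (r : α → ℝ) : Prop :=
  ∃ f : α × ℕ → ℚ, ComputableRat f ∧ ∀ i n, |r i - (f (i, n) : ℝ)| ≤ (1 / 2) ^ n

/-- The metric space `X` with the designated sequence `a` is a computable metric space. -/
structure IsComputableMetricSpace {X : Type*} [MetricSpace X] (a : ℕ → X) : Prop where
  dense : DenseRange a
  dist_computable : ComputableReal fun ij : ℕ × ℕ => dist (a ij.1) (a ij.2)

/-- A computable Polish space is a complete computable metric space. -/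
structure IsComputablePolishSpace {X : Type*} [MetricSpace X] (a : ℕ → X) : Prop
    extends IsComputableMetricSpace a where
  complete : CompleteSpace X

/-- The representation of a computable metric space: a point is given as the limit of a fast
converging sequence of designated points. -/
def IsComputableMetricSpace.represented {X : Type*} [MetricSpace X] {a : ℕ → X}
    (ha : IsComputableMetricSpace a) : RepresentedSpace X where
  IsName p x := ∀ n, dist (a (p n)) x < (1 / 2) ^ n
  unique {p x y} hx hy := by
    have lim : ∀ z : X, (∀ n, dist (a (p n)) z < (1 / 2) ^ n) →
        Tendsto (fun n => a (p n)) atTop (𝓝 z) := fun z hz =>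
      tendsto_iff_dist_tendsto_zero.2 <|
        squeeze_zero (fun _ => dist_nonneg) (fun n => (hz n).le)
          (tendsto_pow_atTop_nhds_zero_of_lt_one (by norm_num) (by norm_num))
    exact tendsto_nhds_unique (lim x hx) (lim y hy)
  exists_name x := by
    have h : ∀ n : ℕ, ∃ i, dist (a i) x < (1 / 2) ^ n := fun n => by
      obtain ⟨i, hi⟩ := ha.dense.exists_dist_lt x (ε := (1 / 2) ^ n) (by positivity)
      exact ⟨i, by rwa [dist_comm]⟩
    choose p hp using h
    exact ⟨p, hp⟩

/-!
Both conditions are equivalent to computable total boundedness, `HasComputableNets`: from `k` one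
can compute a finite list of designated points whose balls of radius `2 ^ (-k)` cover the space.

* If the space is computably compact, then the program that semidecides whether a sequence of balls
  covers the space halts on the sequence of all balls of radius `2 ^ (-k)` around designated points,
  and the finite prefix it has read already covers
  (`IsComputableMetricSpace.hasComputableNets_of_computablyCompact`).
* Given computable nets, every point has a name chosen from finite nets subject to closed
  consistency conditions, and by completeness every consistent choice is a name. The consistent
  choices form a compact set of names, so by König's lemma a semidecision procedure that accepts all
  points accepts all consistent finite choices of some length, which is semidecidable
  (`IsComputableMetricSpace.computablyCompact_of_hasComputableNets`).
* Given computable nets, the maximal size of an `ε`-separated family is a finite antitone function of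
  `ε`, hence constant on intervals arbitrarily close to `0`. For a dyadic rational inside such an
  interval the lower bound is witnessed by a list of designated points, and the upper bound by
  finitely many strict inequalities between distances of points of a net, so a pair `(ε, s)` is found
  by search (`IsComputableMetricSpace.exists_separation_of_hasComputableNets`).
* If the maximal size is known, a maximal `ε`-separated list of designated points is found by search,
  and by maximality it is an `ε`-net (`IsComputableMetricSpace.hasComputableNets_of_separation`).

All searches are justified by closure properties of recursively enumerable predicates, together with
the fact that strict inequalities between distances and rationals are recursively enumerable.
-/

/-! ### Recursively enumerable predicates -/

section RecursivelyEnumerable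

variable {α β : Type*} [Primcodable α] [Primcodable β]

/-- A predicate is recursively enumerable iff it is the projection of a decidable one: the second
argument bounds the running time. -/
theorem rePred_iff_exists_computable {p : α → Prop} :
    REPred p ↔ ∃ R : α × ℕ → Bool, Computable R ∧ ∀ x, p x ↔ ∃ n, R (x, n) = true := by
  constructor
  · intro h
    obtain ⟨c, hc⟩ := Nat.Partrec.Code.exists_code.1 h
    refine ⟨fun z => (Nat.Partrec.Code.evaln z.2 c (Encodable.encode z.1)).isSome, ?_, fun x => ?_⟩
    · exact Primrec.to_comp (Primrec.option_isSome.comp (Nat.Partrec.Code.primrec_evaln.comp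
        (((Primrec.snd.pair (Primrec.const c)).pair (Primrec.encode.comp Primrec.fst)))))
    · have hx : p x ↔ (Nat.Partrec.Code.eval c (Encodable.encode x)).Dom := by
        rw [hc]; simp [Part.assert]
      simp only [hx, Part.dom_iff_mem, Nat.Partrec.Code.evaln_complete, Option.isSome_iff_exists,
        Option.mem_def]
      exact exists_comm
  · rintro ⟨R, hR, hp⟩
    have h : Partrec fun x => Nat.rfind fun n => (Part.some (R (x, n)) : Part Bool) :=
      Partrec.rfind hR.partrec
    refine h.dom_re.of_eq fun x => ?_
    rw [hp]
    exact Nat.rfind_dom'.trans (by simp)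

theorem REPred.comp {p : β → Prop} (hp : REPred p) {f : α → β} (hf : Computable f) :
    REPred fun x => p (f x) :=
  Partrec.comp hp hf

theorem PrimrecPred.rePred {p : α → Prop} (hp : PrimrecPred p) : REPred p :=
  hp.computablePred.to_re

theorem REPred.and {p q : α → Prop} (hp : REPred p) (hq : REPred q) :
    REPred fun x => p x ∧ q x := by
  have h : Partrec fun x => (Part.assert (p x) fun _ => Part.some ()).bind
      fun _ => Part.assert (q x) fun _ => Part.some () :=
    Partrec.bind hp (hq.comp Computable.fst).to₂
  exact h.dom_re.of_eq fun x => by simp [Part.assert]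

theorem REPred.or {p q : α → Prop} (hp : REPred p) (hq : REPred q) :
    REPred fun x => p x ∨ q x := by
  obtain ⟨R, hR, hpR⟩ := rePred_iff_exists_computable.1 hp
  obtain ⟨S, hS, hqS⟩ := rePred_iff_exists_computable.1 hq
  exact rePred_iff_exists_computable.2
    ⟨fun z => R z || S z, Primrec.or.to_comp.comp hR hS, fun x => by
      simp [hpR, hqS, exists_or]⟩

theorem REPred.exists_nat {p : α × ℕ → Prop} (hp : REPred p) : REPred fun x => ∃ n, p (x, n) := by
  obtain ⟨R, hR, hpR⟩ := rePred_iff_exists_computable.1 hp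
  refine rePred_iff_exists_computable.2
    ⟨fun z => R ((z.1, z.2.unpair.1), z.2.unpair.2), hR.comp
      ((Computable.fst.pair (Computable.fst.comp (Computable.unpair.comp Computable.snd))).pair
        (Computable.snd.comp (Computable.unpair.comp Computable.snd))), fun x => ?_⟩
  simp only [hpR]
  constructor
  · rintro ⟨n, m, h⟩
    exact ⟨Nat.pair n m, by simpa using h⟩
  · rintro ⟨k, h⟩
    exact ⟨_, _, h⟩

theorem REPred.forall_lt {p : α × ℕ → Prop} (hp : REPred p) {N : α → ℕ} (hN : Computable N) :
    REPred fun x => ∀ n < N x, p (x, n) := by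
  have h : Partrec fun x => (Nat.rec (Part.some ()) (fun n (r : Part Unit) => r.bind
      fun _ => Part.assert (p (x, n)) fun _ => Part.some ()) (N x) : Part Unit) :=
    Partrec.nat_rec hN (Computable.const ()).partrec
      (hp.comp (Computable.fst.pair (Computable.fst.comp Computable.snd))).to₂
  refine h.dom_re.of_eq fun x => ?_
  generalize N x = m
  induction m with
  | zero => simp
  | succ m ih =>
    rw [Nat.forall_lt_succ_right, ← ih]
    simp [Part.assert]

theorem Computable.list_getD {l : α → List β} {n : α → ℕ} (hl : Computable l) (hn : Computable n)
    (d : β) : Computable fun x => (l x).getD (n x) d :=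
  (Primrec.list_getD d).to_comp.comp hl hn

theorem REPred.forall_mem [Inhabited β] {p : α × β → Prop} (hp : REPred p) {l : α → List β}
    (hl : Computable l) : REPred fun x => ∀ y ∈ l x, p (x, y) := by
  have h : REPred fun z : α × ℕ => p (z.1, (l z.1).getD z.2 default) :=
    hp.comp (Computable.fst.pair
      (Computable.list_getD (hl.comp Computable.fst) Computable.snd default))
  refine (h.forall_lt (Computable.list_length.comp hl)).of_eq fun x => ?_
  rw [List.forall_mem_iff_getElem]
  exact forall₂_congr fun n hn => by rw [List.getD_eq_getElem _ _ hn]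

/-- Unbounded search: a witness for a recursively enumerable relation can be found computably
wherever one exists. -/
theorem REPred.exists_computable_choice [Inhabited β] {p : α × β → Prop} (hp : REPred p)
    (h : ∀ x, ∃ y, p (x, y)) : ∃ g : α → β, Computable g ∧ ∀ x, p (x, g x) := by
  obtain ⟨R, hR, hpR⟩ := rePred_iff_exists_computable.1 hp
  let dec : ℕ → β := fun n => ((Encodable.decode n.unpair.1 : Option β)).getD default
  have hdec : Computable dec :=
    Computable.option_getD
      (Computable.decode.comp (Computable.fst.comp Computable.unpair)) (Computable.const _)
  have hex : ∀ x, ∃ n, R ((x, dec n), n.unpair.2) = true := fun x => by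
    obtain ⟨y, hy⟩ := h x
    obtain ⟨m, hm⟩ := (hpR _).1 hy
    exact ⟨Nat.pair (Encodable.encode y) m, by simpa [dec] using hm⟩
  have hR' : Partrec fun x => Nat.rfind
      fun n => (Part.some (R ((x, dec n), n.unpair.2)) : Part Bool) :=
    Partrec.rfind (hR.comp ((Computable.fst.pair (hdec.comp Computable.snd)).pair
        (Computable.snd.comp (Computable.unpair.comp Computable.snd)))).partrec
  have hfind : Computable fun x => Nat.find (hex x) := by
    refine hR'.of_eq_tot fun x => ?_
    refine Nat.mem_rfind.2 ⟨?_, fun {m} hm => ?_⟩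
    · simpa using (Nat.find_spec (hex x)).symm
    · have := Nat.find_min (hex x) hm
      simpa using this
  exact ⟨fun x => dec (Nat.find (hex x)), hdec.comp hfind,
    fun x => (hpR _).2 ⟨_, Nat.find_spec (hex x)⟩⟩

theorem Computable.list_map_range {f : α × ℕ → β} (hf : Computable f) {N : α → ℕ}
    (hN : Computable N) : Computable fun x => (List.range (N x)).map fun n => f (x, n) := by
  have h : Computable fun x => (Nat.rec [] (fun n (l : List β) => l ++ [f (x, n)]) (N x) :
      List β) :=
    Computable.nat_rec hN (Computable.const []) (Computable.list_concat.comp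
      (Computable.snd.comp Computable.snd)
      (hf.comp (Computable.fst.pair (Computable.fst.comp Computable.snd)))).to₂
  refine h.of_eq fun x => ?_
  generalize N x = m
  induction m with
  | zero => rfl
  | succ m ih => simp [ih, List.range_succ]

theorem Primrec.list_sections : Primrec (List.sections : List (List β) → List (List β)) := by
  have h : Primrec fun L : List (List β) => L.foldr
      (fun l S => S.flatMap fun s => l.map fun b => b :: s) [[]] :=
    Primrec.list_foldr Primrec.id (Primrec.const [[]])
      (Primrec.list_flatMap (Primrec.snd.comp Primrec.snd)
        (Primrec.list_map (Primrec.fst.comp (Primrec.snd.comp Primrec.fst))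
          (Primrec.list_cons.comp Primrec.snd (Primrec.snd.comp Primrec.fst)).to₂).to₂).to₂
  refine h.of_eq fun L => ?_
  induction L with
  | nil => rfl
  | cons l L ih => simp [← ih]

theorem Computable.two_pow {f : α → ℕ} (hf : Computable f) : Computable fun x => 2 ^ f x := by
  have h : Primrec fun n : ℕ => (Nat.rec 1 (fun _ r => r * 2) n : ℕ) :=
    Primrec.nat_rec₁ 1 (Primrec.nat_mul.comp Primrec.snd (Primrec.const 2)).to₂
  refine (h.to_comp.comp hf).of_eq fun x => ?_
  generalize f x = m
  induction m with
  | zero => rfl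
  | succ m ih => simp [pow_succ, ← ih]

theorem Computable.nat_add {f g : α → ℕ} (hf : Computable f) (hg : Computable g) :
    Computable fun x => f x + g x := Primrec.nat_add.to_comp.comp hf hg

theorem Computable.nat_sub {f g : α → ℕ} (hf : Computable f) (hg : Computable g) :
    Computable fun x => f x - g x := Primrec.nat_sub.to_comp.comp hf hg

theorem Computable.nat_mul {f g : α → ℕ} (hf : Computable f) (hg : Computable g) :
    Computable fun x => f x * g x := Primrec.nat_mul.to_comp.comp hf hg

theorem REPred.nat_lt {f g : α → ℕ} (hf : Computable f) (hg : Computable g) :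
    REPred fun x => f x < g x :=
  (PrimrecPred.rePred (p := fun z : ℕ × ℕ => z.1 < z.2)
    (Primrec.nat_lt.comp Primrec.fst Primrec.snd)).comp (hf.pair hg)

theorem REPred.nat_eq {f g : α → ℕ} (hf : Computable f) (hg : Computable g) :
    REPred fun x => f x = g x :=
  (PrimrecPred.rePred (p := fun z : ℕ × ℕ => z.1 = z.2)
    (Primrec.eq.comp Primrec.fst Primrec.snd)).comp (hf.pair hg)

end RecursivelyEnumerable

/-! ### Comparing computable reals with rationals -/

section Comparison

variable {α β : Type*} [Primcodable α] [Primcodable β]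

/-- Natural numbers `D (x, n)` serve as numerators of dyadic approximations, which avoids computing
with signs and denominators. -/
theorem ComputableReal.exists_dyadic_approx {r : α → ℝ} (hr : ComputableReal r)
    (h0 : ∀ x, 0 ≤ r x) :
    ∃ D : α × ℕ → ℕ, Computable D ∧ ∀ x n, |r x * 2 ^ n - D (x, n)| ≤ 2 := by
  obtain ⟨f, ⟨s, a, b, hs, ha, hb, hf⟩, hfr⟩ := hr
  refine ⟨fun z => bif (s z).bodd then 0 else a z * 2 ^ z.2 / b z,
    Computable.cond (Computable.nat_bodd.comp hs) (Computable.const 0)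
      (Primrec.nat_div.to_comp.comp (ha.nat_mul Computable.snd.two_pow) hb), fun x n => ?_⟩
  obtain ⟨hb0, hfe⟩ := hf (x, n)
  have hb' : (0 : ℝ) < b (x, n) := by exact_mod_cast Nat.pos_of_ne_zero hb0
  have h2 : (0 : ℝ) < 2 ^ n := by positivity
  have hd : |r x * 2 ^ n - f (x, n) * 2 ^ n| ≤ 1 := by
    rw [← sub_mul, abs_mul, abs_of_pos h2]
    calc _ ≤ (1 / 2 : ℝ) ^ n * 2 ^ n := mul_le_mul_of_nonneg_right (hfr x n) h2.le
      _ = 1 := by rw [← mul_pow]; norm_num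
  have hr0 : 0 ≤ r x * 2 ^ n := mul_nonneg (h0 x) h2.le
  rw [abs_le] at hd ⊢
  rcases hpar : (s (x, n)).bodd with _ | _
  · -- The sign is positive, and rounding down costs at most one more unit.
    have hev : Even (s (x, n)) := by
      rw [Nat.even_iff]; rw [Nat.mod_two_of_bodd, hpar]; rfl
    have hfe' : (f (x, n) : ℝ) = a (x, n) / b (x, n) := by
      rw [hfe, hev.neg_one_pow]; push_cast; ring
    have hq : (f (x, n) : ℝ) * 2 ^ n = ((a (x, n) * 2 ^ n : ℕ) : ℝ) / b (x, n) := by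
      rw [hfe']; push_cast; ring
    have h1 : ((a (x, n) * 2 ^ n / b (x, n) : ℕ) : ℝ) ≤ (f (x, n) : ℝ) * 2 ^ n := by
      rw [hq]; exact Nat.cast_div_le
    have h3 : (f (x, n) : ℝ) * 2 ^ n < ((a (x, n) * 2 ^ n / b (x, n) : ℕ) : ℝ) + 1 := by
      rw [hq, div_lt_iff₀' hb']
      exact_mod_cast Nat.lt_mul_div_succ _ (Nat.pos_of_ne_zero hb0)
    simp only [hpar, cond_false]
    constructor <;> linarith [hd.1, hd.2]
  · -- A nonpositive approximation of a nonnegative number may be replaced by `0`.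
    have hodd : Odd (s (x, n)) := by
      rw [Nat.odd_iff]; rw [Nat.mod_two_of_bodd, hpar]; rfl
    have hf0 : (f (x, n) : ℝ) * 2 ^ n ≤ 0 := by
      rw [hfe, hodd.neg_one_pow]
      push_cast
      have : (0 : ℝ) ≤ a (x, n) / b (x, n) * 2 ^ n := by positivity
      linarith [neg_one_mul ((a (x, n) : ℝ) / b (x, n) * 2 ^ n),
        show (-1 * (a (x, n) : ℝ) / b (x, n)) * 2 ^ n = -(a (x, n) / b (x, n) * 2 ^ n) by ring]
    simp only [hpar, cond_true, Nat.cast_zero]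
    constructor <;> linarith [hd.1, hd.2]

theorem exists_lt_mul_two_pow (c : ℝ) {δ : ℝ} (hδ : 0 < δ) : ∃ n : ℕ, c < δ * 2 ^ n := by
  obtain ⟨n, hn⟩ := pow_unbounded_of_one_lt (c / δ) (one_lt_two : (1 : ℝ) < 2)
  exact ⟨n, by rwa [div_lt_iff₀' hδ] at hn⟩

/-- Multiplying by `v` instead of dividing by it keeps the comparison with `u / v` in `ℕ`. -/
theorem ComputableReal.rePred_mul_lt {r : α → ℝ} (hr : ComputableReal r) (h0 : ∀ x, 0 ≤ r x)
    {g : β → α} (hg : Computable g) {u v : β → ℕ} (hu : Computable u) (hv : Computable v) :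
    REPred fun y => r (g y) * v y < u y := by
  obtain ⟨D, hD, hDr⟩ := hr.exists_dyadic_approx h0
  have h : REPred fun z : β × ℕ => (D (g z.1, z.2) + 2) * v z.1 < u z.1 * 2 ^ z.2 :=
    REPred.nat_lt (((hD.comp ((hg.comp Computable.fst).pair Computable.snd)).nat_add
      (Computable.const 2)).nat_mul (hv.comp Computable.fst))
      ((hu.comp Computable.fst).nat_mul Computable.snd.two_pow)
  refine h.exists_nat.of_eq fun y => ?_
  have hv0 : (0 : ℝ) ≤ v y := Nat.cast_nonneg _
  constructor
  · rintro ⟨n, hn⟩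
    have hn' : ((D (g y, n) : ℝ) + 2) * v y < u y * 2 ^ n := by exact_mod_cast hn
    have := mul_le_mul_of_nonneg_right (abs_le.1 (hDr (g y) n)).2 hv0
    have h2 : (0 : ℝ) < 2 ^ n := by positivity
    by_contra! hlt
    have := mul_le_mul_of_nonneg_right hlt h2.le
    linarith
  · intro hlt
    obtain ⟨n, hn⟩ := exists_lt_mul_two_pow (4 * v y) (sub_pos.2 hlt)
    refine ⟨n, ?_⟩
    have := mul_le_mul_of_nonneg_right (abs_le.1 (hDr (g y) n)).1 hv0
    have : ((D (g y, n) : ℝ) + 2) * v y < u y * 2 ^ n := by linarith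
    exact_mod_cast this

theorem ComputableReal.rePred_lt_mul {r : α → ℝ} (hr : ComputableReal r) (h0 : ∀ x, 0 ≤ r x)
    {g : β → α} (hg : Computable g) {u v : β → ℕ} (hu : Computable u) (hv : Computable v) :
    REPred fun y => (u y : ℝ) < r (g y) * v y := by
  obtain ⟨D, hD, hDr⟩ := hr.exists_dyadic_approx h0
  have h : REPred fun z : β × ℕ => u z.1 * 2 ^ z.2 + 2 * v z.1 < D (g z.1, z.2) * v z.1 :=
    REPred.nat_lt (((hu.comp Computable.fst).nat_mul Computable.snd.two_pow).nat_add
      ((Computable.const 2).nat_mul (hv.comp Computable.fst)))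
      ((hD.comp ((hg.comp Computable.fst).pair Computable.snd)).nat_mul (hv.comp Computable.fst))
  refine h.exists_nat.of_eq fun y => ?_
  have hv0 : (0 : ℝ) ≤ v y := Nat.cast_nonneg _
  constructor
  · rintro ⟨n, hn⟩
    have hn' : (u y : ℝ) * 2 ^ n + 2 * v y < D (g y, n) * v y := by exact_mod_cast hn
    have := mul_le_mul_of_nonneg_right (abs_le.1 (hDr (g y) n)).1 hv0
    have h2 : (0 : ℝ) < 2 ^ n := by positivity
    by_contra! hlt
    have := mul_le_mul_of_nonneg_right hlt h2.le
    linarith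
  · intro hlt
    obtain ⟨n, hn⟩ := exists_lt_mul_two_pow (4 * v y) (sub_pos.2 hlt)
    refine ⟨n, ?_⟩
    have := mul_le_mul_of_nonneg_right (abs_le.1 (hDr (g y) n)).2 hv0
    have : (u y : ℝ) * 2 ^ n + 2 * v y < D (g y, n) * v y := by linarith
    exact_mod_cast this

end Comparison

namespace IsComputableMetricSpace

variable {X : Type*} [MetricSpace X] {a : ℕ → X} {β : Type*} [Primcodable β]

theorem rePred_dist_mul_lt (ha : IsComputableMetricSpace a) {i j u v : β → ℕ} (hi : Computable i)
    (hj : Computable j) (hu : Computable u) (hv : Computable v) :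
    REPred fun y => dist (a (i y)) (a (j y)) * v y < u y :=
  ha.dist_computable.rePred_mul_lt (fun _ => dist_nonneg) (hi.pair hj) hu hv

theorem rePred_lt_dist_mul (ha : IsComputableMetricSpace a) {i j u v : β → ℕ} (hi : Computable i)
    (hj : Computable j) (hu : Computable u) (hv : Computable v) :
    REPred fun y => (u y : ℝ) < dist (a (i y)) (a (j y)) * v y :=
  ha.dist_computable.rePred_lt_mul (fun _ => dist_nonneg) (hi.pair hj) hu hv

end IsComputableMetricSpace

/-! ### Computable compactness yields computable finite nets -/

/-- Computable total boundedness: from `k` one can compute a finite list of indices of designated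
points whose open balls of radius `2 ^ (-k)` cover the space. -/
def HasComputableNets {X : Type*} [MetricSpace X] (a : ℕ → X) : Prop :=
  ∃ F : ℕ → List ℕ, Computable F ∧ ∀ k x, ∃ c ∈ F k, dist (a c) x < (1 / 2) ^ k

theorem List.getD_map_range {β : Type*} (f : ℕ → β) {n i : ℕ} (h : i < n) (d : β) :
    ((List.range n).map f).getD i d = f i := by
  simp [List.getD_eq_getElem?_getD, h]

/-- Baire space, where every sequence is its own only name. -/
def RepresentedSpace.baire : RepresentedSpace (ℕ → ℕ) where
  IsName p y := p = y
  unique h h' := h.symm.trans h'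
  exists_name y := ⟨y, rfl⟩

/-- Truncated subtraction does no harm here, since both sides fail when `m < k`. -/
theorem mul_two_pow_lt_sub_iff {d : ℝ} (hd : 0 ≤ d) (m k : ℕ) :
    d * (2 ^ (m + k) : ℕ) < (2 ^ m - 2 ^ k : ℕ) ↔ d + (1 / 2) ^ m < (1 / 2) ^ k := by
  have hm : (0 : ℝ) < 2 ^ m := by positivity
  have hk : (0 : ℝ) < 2 ^ k := by positivity
  have key : d + (1 / 2) ^ m < (1 / 2) ^ k ↔ d * (2 ^ m * 2 ^ k) + 2 ^ k < 2 ^ m := by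
    rw [one_div, inv_pow, inv_pow, ← mul_lt_mul_iff_left₀ (mul_pos hm hk)]
    have h1 : (d + ((2 : ℝ) ^ m)⁻¹) * (2 ^ m * 2 ^ k) = d * (2 ^ m * 2 ^ k) + 2 ^ k := by
      field_simp
    have h2 : ((2 : ℝ) ^ k)⁻¹ * (2 ^ m * 2 ^ k) = 2 ^ m := by field_simp
    rw [h1, h2]
  have hpos : 0 ≤ d * (2 ^ m * 2 ^ k : ℝ) := by positivity
  rw [key, pow_add]
  rcases le_total (2 ^ k) (2 ^ m : ℕ) with h | h
  · rw [Nat.cast_sub h]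
    push_cast
    exact lt_sub_iff_add_lt
  · rw [Nat.sub_eq_zero_of_le h]
    have h' : (2 : ℝ) ^ m ≤ 2 ^ k := by exact_mod_cast h
    push_cast
    exact ⟨fun h => absurd h (not_lt.2 hpos), fun h => by linarith⟩

namespace IsComputableMetricSpace

variable {X : Type*} [MetricSpace X] {a : ℕ → X}

/-- Membership of `x` in the union of the balls of radius `2 ^ (-y 0)` around the designated points
with indices `y 1, y 2, …` is semidecidable. -/
theorem computablyOpen_union_balls (ha : IsComputableMetricSpace a) :
    (RepresentedSpace.baire.prod ha.represented).ComputablyOpen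
      {z : (ℕ → ℕ) × X | ∃ n, dist (a (z.1 (n + 1))) z.2 < (1 / 2) ^ z.1 0} := by
  let W : List ℕ × ℕ → Prop := fun z => z.2 + 1 < z.1.length ∧
    dist (a (z.1.getD (z.2 + 1) 0).unpair.1) (a (z.1.getD (z.1.length - 1) 0).unpair.2) *
      (2 ^ (z.1.length - 1 + (z.1.getD 0 0).unpair.1) : ℕ) <
      (2 ^ (z.1.length - 1) - 2 ^ (z.1.getD 0 0).unpair.1 : ℕ)
  have hW : REPred W := by
    have hn : Computable fun z : List ℕ × ℕ => z.2 + 1 :=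
      Computable.snd.nat_add (Computable.const 1)
    have hlen : Computable fun z : List ℕ × ℕ => z.1.length :=
      Computable.list_length.comp Computable.fst
    have hm : Computable fun z : List ℕ × ℕ => z.1.length - 1 := hlen.nat_sub (Computable.const 1)
    have hk : Computable fun z : List ℕ × ℕ => (z.1.getD 0 0).unpair.1 :=
      Computable.fst.comp (Computable.unpair.comp
        (Computable.list_getD Computable.fst (Computable.const 0) 0))
    exact (REPred.nat_lt hn hlen).and (ha.rePred_dist_mul_lt
      (Computable.fst.comp (Computable.unpair.comp (Computable.list_getD Computable.fst hn 0)))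
      (Computable.snd.comp (Computable.unpair.comp (Computable.list_getD Computable.fst hm 0)))
      (hm.two_pow.nat_sub hk.two_pow) (hm.nat_add hk).two_pow)
  refine ⟨fun l => ∃ n, W (l, n), hW.exists_nat, ?_⟩
  rintro r ⟨y, x⟩ ⟨hy, hx⟩
  obtain rfl : (fun n => (r n).unpair.1) = y := hy
  have hx' : ∀ n, dist (a (r n).unpair.2) x < (1 / 2) ^ n := hx
  -- With `m + 1` entries read, the last one approximates `x` to within `2 ^ (-m)`.
  have hWr : ∀ m n, W ((List.range (m + 1)).map r, n) ↔ n < m ∧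
      dist (a (r (n + 1)).unpair.1) (a (r m).unpair.2) + (1 / 2) ^ m
        < (1 / 2) ^ (r 0).unpair.1 := by
    intro m n
    simp only [W, List.length_map, List.length_range, Nat.add_sub_cancel]
    rw [mul_two_pow_lt_sub_iff dist_nonneg, List.getD_map_range _ (Nat.succ_pos m),
      List.getD_map_range _ (Nat.lt_succ_self m), Nat.add_lt_add_iff_right]
    exact and_congr_right fun h => by rw [List.getD_map_range _ (Nat.succ_lt_succ h)]
  change (∃ n, dist (a (r (n + 1)).unpair.1) x < (1 / 2) ^ (r 0).unpair.1) ↔ _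
  constructor
  · rintro ⟨n, hn⟩
    obtain ⟨m, hm⟩ := exists_lt_mul_two_pow 2 (sub_pos.2 hn)
    have hN : 2 * (1 / 2 : ℝ) ^ max m (n + 1) <
        (1 / 2) ^ (r 0).unpair.1 - dist (a (r (n + 1)).unpair.1) x := by
      refine lt_of_le_of_lt (mul_le_mul_of_nonneg_left (pow_le_pow_of_le_one (by norm_num)
        (by norm_num) (le_max_left m (n + 1))) (by norm_num)) ?_
      rw [one_div_pow (2 : ℝ) m, mul_one_div, div_lt_iff₀ (by positivity)]
      exact hm
    refine ⟨max m (n + 1) + 1, n, (hWr _ _).2 ⟨by omega, ?_⟩⟩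
    have h1 := hx' (max m (n + 1))
    have h2 := dist_triangle_right (a (r (n + 1)).unpair.1)
      (a (r (max m (n + 1))).unpair.2) x
    linarith
  · rintro ⟨k, n, h⟩
    obtain _ | m := k
    · simp [W] at h
    · obtain ⟨-, hlt⟩ := (hWr m n).1 h
      exact ⟨n, by linarith [hx' m, dist_triangle (a (r (n + 1)).unpair.1) (a (r m).unpair.2) x]⟩

/-- A program that confirms a covering of the space by an infinite sequence of balls has read only
finitely many of them, so these already cover the space. -/
theorem hasComputableNets_of_computablyCompact (ha : IsComputableMetricSpace a)
    (h : ha.represented.ComputablyCompact) : HasComputableNets a := by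
  obtain ⟨W, hW, hWU⟩ := h _ RepresentedSpace.baire _ ha.computablyOpen_union_balls
  have hWU' : ∀ y : ℕ → ℕ, (∀ x, ∃ n, dist (a (y (n + 1))) x < (1 / 2) ^ y 0) ↔
      ∃ k, W ((List.range k).map y) := fun y => hWU y y rfl
  -- The sequence `k, 0, 1, 2, …` lists all balls of radius `2 ^ (-k)` around designated points.
  let y : ℕ × ℕ → ℕ := fun z => Nat.casesOn z.2 z.1 fun n => n
  have hy : Computable y := Computable.nat_casesOn Computable.snd Computable.fst Computable.snd.to₂
  have hR : REPred fun z : ℕ × ℕ => W ((List.range z.2).map fun n => y (z.1, n)) :=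
    hW.comp (Computable.list_map_range
      (hy.comp ((Computable.fst.comp Computable.fst).pair Computable.snd)) Computable.snd)
  obtain ⟨g, hg, hgW⟩ := hR.exists_computable_choice fun k => by
    refine (hWU' fun n => y (k, n)).1 fun x => ?_
    obtain ⟨n, hn⟩ := ha.dense.exists_dist_lt x (ε := (1 / 2) ^ k) (by positivity)
    exact ⟨n, by simpa [y, dist_comm] using hn⟩
  refine ⟨fun k => List.range (g k + 1),
    Primrec.list_range.to_comp.comp (hg.nat_add (Computable.const 1)), fun k x => ?_⟩
  -- The continuation by zeros of the accepted prefix is accepted as well.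
  let y' : ℕ → ℕ := fun n => Nat.casesOn n k fun n => if n + 1 < g k then n else 0
  have hy' : (List.range (g k)).map y' = (List.range (g k)).map fun n => y (k, n) :=
    List.map_congr_left fun n hn => by
      cases n with
      | zero => rfl
      | succ n => simp [y', y, List.mem_range.1 hn]
  obtain ⟨n, hn⟩ := (hWU' y').2 ⟨g k, hy' ▸ hgW k⟩ x
  refine ⟨y' (n + 1), ?_, hn⟩
  simp only [y', List.mem_range]
  split_ifs <;> omega

end IsComputableMetricSpace

/-! ### Computable finite nets yield computable compactness -/

theorem add_two_pow_lt_mul_iff (d : ℝ) (i j : ℕ) :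
    ((2 ^ i + 2 ^ j : ℕ) : ℝ) < d * (2 ^ (i + j) : ℕ) ↔ (1 / 2) ^ i + (1 / 2) ^ j < d := by
  have hi : (0 : ℝ) < 2 ^ i := by positivity
  have hj : (0 : ℝ) < 2 ^ j := by positivity
  have h : ((1 / 2 : ℝ) ^ i + (1 / 2) ^ j) * (2 ^ i * 2 ^ j) = 2 ^ i + 2 ^ j := by
    rw [one_div_pow, one_div_pow]
    field_simp
    ring
  refine Iff.trans ?_ (mul_lt_mul_iff_left₀ (mul_pos hi hj))
  rw [h, pow_add]
  push_cast
  rfl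

theorem List.mem_sections_map_range {β : Type*} {f : ℕ → List β} {k : ℕ} {t : List β} (d : β) :
    t ∈ List.sections ((List.range k).map f) ↔ t.length = k ∧ ∀ i < k, t.getD i d ∈ f i := by
  rw [List.mem_sections, List.forall₂_iff_get]
  simp only [List.length_map, List.length_range, List.get_eq_getElem, List.getElem_map,
    List.getElem_range]
  refine and_congr_right fun h => ⟨fun H i hi => ?_, fun H i hi hik => ?_⟩
  · rw [List.getD_eq_getElem _ _ (h ▸ hi)]
    exact H i (h ▸ hi) hi
  · rw [← List.getD_eq_getElem _ d hi]
    exact H i hik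

/-- König's lemma, for infinite branches of a finitely branching tree. If for every `k` some
selection from the finite sets `f 0, f 1, …` satisfies `Q k`, and `Q m` is inherited by all
sequences that agree on the first `m` entries with one satisfying some `Q k`, `m ≤ k`, then a single
selection satisfies all `Q m`. -/
theorem exists_selection_of_forall_exists {f : ℕ → List ℕ} {Q : ℕ → (ℕ → ℕ) → Prop}
    (hQ : ∀ k, ∃ p, (∀ i, p i ∈ f i) ∧ Q k p)
    (hmono : ∀ m k p p', m ≤ k → (∀ i < m, p i = p' i) → Q k p → Q m p') :
    ∃ p, (∀ i, p i ∈ f i) ∧ ∀ m, Q m p := by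
  choose P hPf hPQ using hQ
  have hK : IsCompact (Set.univ.pi fun i => {c | c ∈ f i}) :=
    isCompact_univ_pi fun i => (List.finite_toSet (f i)).isCompact
  obtain ⟨p, hp, φ, hφ, hlim⟩ := hK.tendsto_subseq (x := P) fun k i _ => hPf k i
  refine ⟨p, fun i => hp i trivial, fun m => ?_⟩
  have hev : ∀ᶠ n in atTop, ∀ i ∈ Set.Iio m, P (φ n) i = p i := by
    refine (Set.finite_Iio m).eventually_all.2 fun i _ => ?_
    have := tendsto_pi_nhds.1 hlim i
    rw [nhds_discrete, tendsto_pure] at this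
    exact this
  obtain ⟨n, hn, hmn⟩ := (hev.and (eventually_ge_atTop m)).exists
  exact hmono m (φ n) _ _ (hmn.trans hφ.le_apply) hn (hPQ _)

namespace IsComputableMetricSpace

variable {X : Type*} [MetricSpace X] {a : ℕ → X}

/-- Sequences of designated points with a suitable modulus of consistency name a point. -/
theorem exists_isName [CompleteSpace X] (ha : IsComputableMetricSpace a) {p : ℕ → ℕ}
    (hp : ∀ i j, dist (a (p i)) (a (p j)) ≤ (1 / 2) ^ (i + 2) + (1 / 2) ^ (j + 2)) :
    ∃ x, ha.represented.IsName p x := by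
  have hmono : ∀ {m n : ℕ}, m ≤ n → (1 / 2 : ℝ) ^ (n + 2) ≤ (1 / 2) ^ (m + 2) := fun h =>
    pow_le_pow_of_le_one (by norm_num) (by norm_num) (by omega)
  have hpow : Tendsto (fun n : ℕ => (1 / 2 : ℝ) ^ (n + 2)) atTop (𝓝 0) :=
    (tendsto_pow_atTop_nhds_zero_of_lt_one (by norm_num) (by norm_num)).comp
      (tendsto_add_atTop_nat 2)
  have hC : CauchySeq fun n => a (p n) :=
    cauchySeq_of_le_tendsto_0 (fun N => (1 / 2 : ℝ) ^ (N + 2) + (1 / 2) ^ (N + 2))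
      (fun n m N hn hm => (hp n m).trans (add_le_add (hmono hn) (hmono hm)))
      (by simpa using hpow.add hpow)
  obtain ⟨x, hx⟩ := cauchySeq_tendsto_of_complete hC
  refine ⟨x, fun n => ?_⟩
  have hle : dist (a (p n)) x ≤ (1 / 2) ^ (n + 2) + 0 :=
    le_of_tendsto_of_tendsto' (tendsto_const_nhds.dist hx) (tendsto_const_nhds.add hpow) (hp n)
  have : (1 / 2 : ℝ) ^ (n + 2) < (1 / 2) ^ n :=
    pow_lt_pow_right_of_lt_one₀ (by norm_num) (by norm_num) (by omega)
  linarith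

/-- Every point has a name chosen from the finite nets `F 2, F 3, …` that is consistent enough. The
consistent choices form a compact set of names, so that a program accepting all of them has already
accepted all consistent finite choices of some length. -/
theorem computablyCompact_of_hasComputableNets [CompleteSpace X] (ha : IsComputableMetricSpace a)
    (h : HasComputableNets a) : ha.represented.ComputablyCompact := by
  obtain ⟨F, hF, hcov⟩ := h
  rintro Y σ U ⟨W, hW, hWU⟩
  -- `V` holds of prefixes `l` and `t` when `t` is seen to be inconsistent, or when the given
  -- program accepts a prefix of the pairing of `l` with `t`.
  let V : List ℕ × List ℕ → Prop := fun z =>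
    (∃ i j, (i < z.1.length ∧ j < z.1.length) ∧
      ((2 ^ (i + 2) + 2 ^ (j + 2) : ℕ) : ℝ) <
        dist (a (z.2.getD i 0)) (a (z.2.getD j 0)) * (2 ^ (i + 2 + (j + 2)) : ℕ)) ∨
    ∃ j, j < z.1.length + 1 ∧
      W ((List.range j).map fun i => Nat.pair (z.1.getD i 0) (z.2.getD i 0))
  have hV : REPred V := by
    refine REPred.or (REPred.exists_nat (REPred.exists_nat
      (p := fun z : ((List ℕ × List ℕ) × ℕ) × ℕ =>
        (z.1.2 < z.1.1.1.length ∧ z.2 < z.1.1.1.length) ∧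
          ((2 ^ (z.1.2 + 2) + 2 ^ (z.2 + 2) : ℕ) : ℝ) <
            dist (a (z.1.1.2.getD z.1.2 0)) (a (z.1.1.2.getD z.2 0)) *
              (2 ^ (z.1.2 + 2 + (z.2 + 2)) : ℕ)) ?_))
      (REPred.exists_nat (p := fun z : (List ℕ × List ℕ) × ℕ => z.2 < z.1.1.length + 1 ∧
        W ((List.range z.2).map fun i => Nat.pair (z.1.1.getD i 0) (z.1.2.getD i 0))) ?_)
    · have hi : Computable fun z : ((List ℕ × List ℕ) × ℕ) × ℕ => z.1.2 :=
        Computable.snd.comp Computable.fst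
      have ht : Computable fun z : ((List ℕ × List ℕ) × ℕ) × ℕ => z.1.1.2 :=
        Computable.snd.comp (Computable.fst.comp Computable.fst)
      have hlen : Computable fun z : ((List ℕ × List ℕ) × ℕ) × ℕ => z.1.1.1.length :=
        Computable.list_length.comp (Computable.fst.comp (Computable.fst.comp Computable.fst))
      have hi2 := hi.nat_add (Computable.const 2)
      have hj2 := (Computable.snd (α := (List ℕ × List ℕ) × ℕ) (β := ℕ)).nat_add
        (Computable.const 2)
      exact ((REPred.nat_lt hi hlen).and (REPred.nat_lt Computable.snd hlen)).and
        (ha.rePred_lt_dist_mul (Computable.list_getD ht hi 0)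
          (Computable.list_getD ht Computable.snd 0)
          (hi2.two_pow.nat_add hj2.two_pow) (hi2.nat_add hj2).two_pow)
    · refine (REPred.nat_lt Computable.snd ((Computable.list_length.comp
        (Computable.fst.comp Computable.fst)).nat_add (Computable.const 1))).and
        (hW.comp (Computable.list_map_range
          (f := fun w : ((List ℕ × List ℕ) × ℕ) × ℕ =>
            Nat.pair (w.1.1.1.getD w.2 0) (w.1.1.2.getD w.2 0)) ?_ Computable.snd))
      exact Primrec₂.natPair.to_comp.comp
        (Computable.list_getD (Computable.fst.comp (Computable.fst.comp Computable.fst))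
          Computable.snd 0)
        (Computable.list_getD (Computable.snd.comp (Computable.fst.comp Computable.fst))
          Computable.snd 0)
  have hsec : Computable fun l : List ℕ =>
      List.sections ((List.range l.length).map fun i => F (i + 2)) :=
    Primrec.list_sections.to_comp.comp (Computable.list_map_range
      (f := fun z : List ℕ × ℕ => F (z.2 + 2))
      (hF.comp (Computable.snd.nat_add (Computable.const 2))) Computable.list_length)
  refine ⟨fun l => ∀ t ∈ List.sections ((List.range l.length).map fun i => F (i + 2)), V (l, t),
    hV.forall_mem hsec, fun q y hq => ?_⟩
  -- The meaning of `V` for prefixes of length `k` of `q` and `p`.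
  let V' : ℕ → (ℕ → ℕ) → Prop := fun k p =>
    (∃ i j, (i < k ∧ j < k) ∧
      (1 / 2 : ℝ) ^ (i + 2) + (1 / 2) ^ (j + 2) < dist (a (p i)) (a (p j))) ∨
    ∃ j, j < k + 1 ∧ W ((List.range j).map fun i => Nat.pair (q i) (p i))
  have hVV' : ∀ k t p, (∀ i < k, t.getD i 0 = p i) →
      (V ((List.range k).map q, t) ↔ V' k p) := by
    intro k t p htp
    simp only [V, V', List.length_map, List.length_range, add_two_pow_lt_mul_iff]
    refine or_congr (exists₂_congr fun i j => and_congr_right fun hij => ?_)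
      (exists_congr fun j => and_congr_right fun hj => ?_)
    · rw [htp i hij.1, htp j hij.2]
    · refine iff_of_eq (congrArg W (List.map_congr_left fun i hi => ?_))
      have hik : i < k := by have := List.mem_range.1 hi; omega
      rw [List.getD_map_range _ hik, htp i hik]
  have hname : ∀ {p x}, ha.represented.IsName p x → ((y, x) ∈ U ↔
      ∃ j, W ((List.range j).map fun i => Nat.pair (q i) (p i))) := fun {p x} hpx =>
    hWU (fun i => Nat.pair (q i) (p i)) (y, x)
      ⟨by simpa using hq, by simpa using hpx⟩
  simp only [List.length_map, List.length_range]
  constructor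
  · intro hU
    by_contra! hcon
    obtain ⟨p, hpF, hp⟩ := exists_selection_of_forall_exists (f := fun i => F (i + 2))
      (Q := fun k p => ¬ V' k p) (fun k => by
        obtain ⟨t, ht, hVt⟩ := hcon k
        have htF := ((List.mem_sections_map_range 0).1 ht).2
        choose b hb using fun i => hcov (i + 2) (a 0)
        refine ⟨fun i => if i < k then t.getD i 0 else b i, fun i => ?_, ?_⟩
        · dsimp only
          split_ifs with hi
          exacts [htF i hi, (hb i).1]
        · rwa [← hVV' k t _ fun i hi => by simp [hi]])
      (fun m k p p' hmk hpp' => mt fun hm => by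
        rcases hm with ⟨i, j, hij, hlt⟩ | ⟨j, hj, hWj⟩
        · refine Or.inl ⟨i, j, by omega, ?_⟩
          rwa [hpp' i hij.1, hpp' j hij.2]
        · refine Or.inr ⟨j, by omega, ?_⟩
          convert hWj using 1
          refine List.map_congr_left fun i hi => ?_
          rw [hpp' i (by have := List.mem_range.1 hi; omega)])
    obtain ⟨x, hx⟩ := ha.exists_isName (p := p) fun i j => by
      by_contra! hlt
      exact hp (max i j + 1) (Or.inl ⟨i, j, by omega, hlt⟩)
    obtain ⟨j, hj⟩ := (hname hx).1 (hU x)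
    exact hp j (Or.inr ⟨j, j.lt_succ_self, hj⟩)
  · rintro ⟨k, hk⟩ x
    choose p hpF hp using fun i => hcov (i + 2) x
    have hpx : ha.represented.IsName p x := fun n => (hp n).trans_le
      (pow_le_pow_of_le_one (by norm_num) (by norm_num) (by omega))
    have ht : ∀ i < k, ((List.range k).map p).getD i 0 = p i := fun i hi =>
      List.getD_map_range p hi 0
    have hVk := (hVV' k _ p ht).1 (hk ((List.range k).map p)
      ((List.mem_sections_map_range 0).2 ⟨by simp, fun i hi => by
        rw [ht i hi]; exact hpF i⟩))
    rcases hVk with ⟨i, j, -, hlt⟩ | ⟨j, -, hj⟩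
    · have := dist_triangle_right (a (p i)) (a (p j)) x
      linarith [hp i, hp j]
    · exact (hname hpx).2 ⟨j, hj⟩

end IsComputableMetricSpace

/-! ### Computable finite nets and the size of separated families -/

/-- There are `m` points of `X` with pairwise distances greater than `t`. -/
def HasSeparated (X : Type*) [MetricSpace X] (t : ℝ) (m : ℕ) : Prop :=
  ∃ x : Fin m → X, ∀ j k, j ≠ k → t < dist (x j) (x k)

section Separated

variable {X : Type*} [MetricSpace X] {a : ℕ → X}

theorem hasSeparated_of_forall_lt {t : ℝ} {m : ℕ} {x : ℕ → X}
    (h : ∀ j < m, ∀ k < j, t < dist (x j) (x k)) : HasSeparated X t m := by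
  refine ⟨fun j => x j, fun j k hjk => ?_⟩
  rcases lt_or_gt_of_ne (Fin.val_ne_of_ne hjk) with hlt | hlt
  · rw [dist_comm]; exact h k k.2 j hlt
  · exact h j j.2 k hlt

/-- Being separated is an open condition, so that a dense sequence has separated families of the
same size. -/
theorem hasSeparated_iff_of_denseRange (ha : DenseRange a) {t : ℝ} {m : ℕ} :
    HasSeparated X t m ↔
      ∃ p : ℕ → ℕ, ∀ j < m, ∀ k < j, t < dist (a (p j)) (a (p k)) := by
  constructor
  · intro h
    have hopen : IsOpen {x : Fin m → X | ∀ j k, j ≠ k → t < dist (x j) (x k)} := by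
      simp only [Set.ofPred_forall]
      exact isOpen_iInter_of_finite fun j => isOpen_iInter_of_finite fun k =>
        isOpen_iInter_of_finite fun _ => isOpen_lt continuous_const
          ((continuous_apply j).dist (continuous_apply k))
    obtain ⟨p, hp⟩ := (DenseRange.piMap fun _ : Fin m => ha).exists_mem_open hopen h
    refine ⟨fun j => if hj : j < m then p ⟨j, hj⟩ else 0, fun j hj k hk => ?_⟩
    have := hp ⟨j, hj⟩ ⟨k, hk.trans hj⟩ (fun h => hk.ne' (Fin.mk.inj_iff.1 h))
    simpa [hj, hk.trans hj] using this
  · rintro ⟨p, hp⟩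
    exact hasSeparated_of_forall_lt hp

theorem HasSeparated.mono_right (ha : DenseRange a) {t : ℝ} {m n : ℕ} (h : HasSeparated X t n)
    (hmn : m ≤ n) : HasSeparated X t m := by
  rw [hasSeparated_iff_of_denseRange ha] at h ⊢
  exact h.imp fun p hp j hj => hp j (hj.trans_le hmn)

theorem isLUB_hasSeparated_iff {t : ℝ} {s : ℕ} (ha : DenseRange a) :
    IsLUB {m | HasSeparated X t m} s ↔ HasSeparated X t s ∧ ¬ HasSeparated X t (s + 1) := by
  constructor
  · intro h
    refine ⟨?_, fun hs => absurd (h.1 hs) (by omega)⟩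
    have hne : {m | HasSeparated X t m}.Nonempty := ⟨0, Fin.elim0, fun j => j.elim0⟩
    have := Nat.sSup_mem hne ⟨s, h.1⟩
    rwa [h.csSup_eq hne] at this
  · rintro ⟨hs, hs'⟩
    exact IsGreatest.isLUB ⟨hs, fun m hm => not_lt.1 fun hlt => hs' (hm.mono_right ha hlt)⟩

theorem HasComputableNets.exists_not_hasSeparated (h : HasComputableNets a) {t : ℝ} (ht : 0 < t) :
    ∃ m, ¬ HasSeparated X t m := by
  obtain ⟨F, -, hcov⟩ := h
  obtain ⟨k, hk⟩ := exists_lt_mul_two_pow 2 ht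
  refine ⟨(F k).length + 1, ?_⟩
  rintro ⟨x, hx⟩
  choose c hcF hc using fun j => hcov k (x j)
  obtain ⟨i, -, j, -, hij, hcij⟩ := Finset.exists_ne_map_eq_of_card_lt_of_maps_to
    (s := Finset.univ) (t := (F k).toFinset) (f := c)
    (by simpa using Nat.lt_succ_of_le (List.toFinset_card_le (F k)))
    (fun j _ => by simpa using hcF j)
  have hk' : 2 * (1 / 2 : ℝ) ^ k < t := by
    rwa [one_div_pow, mul_one_div, div_lt_iff₀ (by positivity)]
  have h1 := hc j
  rw [← hcij] at h1
  linarith [hx i j hij, hc i, dist_triangle_left (x i) (x j) (a (c i))]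

/-- The maximal size of a `t`-separated family is constant in `t` on some nondegenerate
interval arbitrarily close to `0`, since it is finite and antitone in `t`. -/
theorem HasComputableNets.exists_lt_lt_hasSeparated (h : HasComputableNets a) {δ : ℝ}
    (hδ : 0 < δ) : ∃ s t₁ t₂, 0 < t₁ ∧ t₁ < t₂ ∧ t₂ < δ ∧
      HasSeparated X t₂ s ∧ ¬ HasSeparated X t₁ (s + 1) := by
  classical
  have hex : ∃ m t, (0 < t ∧ t < δ) ∧ ¬ HasSeparated X t m := by
    obtain ⟨m, hm⟩ := h.exists_not_hasSeparated (half_pos hδ)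
    exact ⟨m, δ / 2, ⟨half_pos hδ, half_lt_self hδ⟩, hm⟩
  obtain ⟨t₁, ⟨h0, h1⟩, hsep⟩ := Nat.find_spec hex
  obtain ⟨s, hs⟩ : ∃ s, Nat.find hex = s + 1 := Nat.exists_eq_succ_of_ne_zero fun h0 => by
    rw [h0] at hsep
    exact hsep ⟨Fin.elim0, fun j => j.elim0⟩
  refine ⟨s, t₁, (t₁ + δ) / 2, h0, by linarith, by linarith, ?_, hs ▸ hsep⟩
  -- The size `s` is the least maximal size that occurs below `δ`, attained at `t₁`.
  by_contra hcon
  exact Nat.find_min hex (hs ▸ s.lt_succ_self) ⟨(t₁ + δ) / 2, ⟨by linarith, by linarith⟩, hcon⟩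

end Separated

namespace IsComputableMetricSpace

variable {X : Type*} [MetricSpace X] {a : ℕ → X}

/-- For each `i`, search for a dyadic rational `ε = e / 2 ^ n` below `2 ^ (-i)` with an
`ε`-separated list of designated points, such that finitely many strict inequalities between
distances of points of a finite net exclude longer `ε`-separated lists. -/
theorem exists_separation_of_hasComputableNets (ha : IsComputableMetricSpace a)
    (h : HasComputableNets a) :
    ∃ (ε : ℕ → ℚ) (s : ℕ → ℕ), ComputableRat ε ∧ Computable s ∧ (∀ i, 0 < ε i) ∧
      Tendsto (fun i => (ε i : ℝ)) atTop (𝓝 0) ∧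
      ∀ i, IsLUB {m : ℕ | HasSeparated X (ε i) m} (s i) := by
  obtain ⟨F, hF, hcov⟩ := id h
  -- `Lower (i, n, e, L)` witnesses that `L` is `e / 2 ^ n`-separated. In `Upper`, replacing points by
  -- points of the net `F n` changes a distance by at most `2 / 2 ^ n`, whence the term `e - 2`; where
  -- the subtraction truncates, the inequality fails.
  let Lower : ℕ × ℕ × ℕ × List ℕ → Prop := fun z => ∀ j < z.2.2.2.length, ∀ k < j,
    (z.2.2.1 : ℝ) < dist (a (z.2.2.2.getD j 0)) (a (z.2.2.2.getD k 0)) * (2 ^ z.2.1 : ℕ)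
  let Upper : ℕ × ℕ × ℕ × List ℕ → Prop := fun z =>
    ∀ t ∈ List.sections ((List.range (z.2.2.2.length + 1)).map fun _ => F z.2.1),
      ∃ j k, (j < z.2.2.2.length + 1 ∧ k < j) ∧
        dist (a (t.getD j 0)) (a (t.getD k 0)) * (2 ^ z.2.1 : ℕ) < (z.2.2.1 - 2 : ℕ)
  have hn : Computable fun z : ℕ × ℕ × ℕ × List ℕ => z.2.1 :=
    Computable.fst.comp Computable.snd
  have he : Computable fun z : ℕ × ℕ × ℕ × List ℕ => z.2.2.1 :=
    Computable.fst.comp (Computable.snd.comp Computable.snd)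
  have hL : Computable fun z : ℕ × ℕ × ℕ × List ℕ => z.2.2.2 :=
    Computable.snd.comp (Computable.snd.comp Computable.snd)
  have hlen : Computable fun z : ℕ × ℕ × ℕ × List ℕ => z.2.2.2.length :=
    Computable.list_length.comp hL
  have hLower : REPred Lower := by
    refine REPred.forall_lt (REPred.forall_lt
      (p := fun z : ((ℕ × ℕ × ℕ × List ℕ) × ℕ) × ℕ => (z.1.1.2.2.1 : ℝ) <
        dist (a (z.1.1.2.2.2.getD z.1.2 0)) (a (z.1.1.2.2.2.getD z.2 0)) * (2 ^ z.1.1.2.1 : ℕ))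
      ?_ Computable.snd) hlen
    have h11 : Computable fun z : ((ℕ × ℕ × ℕ × List ℕ) × ℕ) × ℕ => z.1.1 :=
      Computable.fst.comp Computable.fst
    exact ha.rePred_lt_dist_mul
      (Computable.list_getD (hL.comp h11) (Computable.snd.comp Computable.fst) 0)
      (Computable.list_getD (hL.comp h11) Computable.snd 0) (he.comp h11) (hn.comp h11).two_pow
  have hUpper : REPred Upper := by
    refine REPred.forall_mem (REPred.exists_nat (REPred.exists_nat
      (p := fun z : (((ℕ × ℕ × ℕ × List ℕ) × List ℕ) × ℕ) × ℕ =>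
        (z.1.2 < z.1.1.1.2.2.2.length + 1 ∧ z.2 < z.1.2) ∧
          dist (a (z.1.1.2.getD z.1.2 0)) (a (z.1.1.2.getD z.2 0)) * (2 ^ z.1.1.1.2.1 : ℕ) <
            (z.1.1.1.2.2.1 - 2 : ℕ)) ?_)) ?_
    · have h1 : Computable fun z : (((ℕ × ℕ × ℕ × List ℕ) × List ℕ) × ℕ) × ℕ => z.1.1.1 :=
        Computable.fst.comp (Computable.fst.comp Computable.fst)
      have ht : Computable fun z : (((ℕ × ℕ × ℕ × List ℕ) × List ℕ) × ℕ) × ℕ => z.1.1.2 :=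
        Computable.snd.comp (Computable.fst.comp Computable.fst)
      have hj : Computable fun z : (((ℕ × ℕ × ℕ × List ℕ) × List ℕ) × ℕ) × ℕ => z.1.2 :=
        Computable.snd.comp Computable.fst
      exact ((REPred.nat_lt hj ((hlen.comp h1).nat_add (Computable.const 1))).and
        (REPred.nat_lt Computable.snd hj)).and (ha.rePred_dist_mul_lt
          (Computable.list_getD ht hj 0) (Computable.list_getD ht Computable.snd 0)
          ((he.comp h1).nat_sub (Computable.const 2)) (hn.comp h1).two_pow)
    · exact Primrec.list_sections.to_comp.comp (Computable.list_map_range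
        (f := fun z : (ℕ × ℕ × ℕ × List ℕ) × ℕ => F z.1.2.1)
        (hF.comp (hn.comp Computable.fst)) (hlen.nat_add (Computable.const 1)))
  have hsmall : REPred fun z : ℕ × ℕ × ℕ × List ℕ => 0 < z.2.2.1 ∧ z.2.2.1 * 2 ^ z.1 < 2 ^ z.2.1 :=
    (REPred.nat_lt (Computable.const 0) he).and
      (REPred.nat_lt (he.nat_mul Computable.fst.two_pow) hn.two_pow)
  obtain ⟨g, hg, hgP⟩ := (hsmall.and (hLower.and hUpper)).exists_computable_choice fun i => by
    obtain ⟨s, t₁, t₂, ht₁, ht₁₂, ht₂, hs, hs'⟩ :=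
      h.exists_lt_lt_hasSeparated (show (0 : ℝ) < (1 / 2) ^ i by positivity)
    obtain ⟨n, hgap⟩ := exists_lt_mul_two_pow 4 (sub_pos.2 ht₁₂)
    have h2 : (0 : ℝ) < 2 ^ n := by positivity
    have ht₁n : 0 < t₁ * 2 ^ n := mul_pos ht₁ h2
    have hle : (⌊t₂ * 2 ^ n⌋₊ : ℝ) ≤ t₂ * 2 ^ n := Nat.floor_le (by nlinarith)
    have hlt := Nat.lt_floor_add_one (t₂ * 2 ^ n)
    -- As `4 < (t₂ - t₁) * 2 ^ n`, also `t₁ < (e - 2) / 2 ^ n` for this numerator `e`.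
    set e := ⌊t₂ * 2 ^ n⌋₊
    have he3 : 3 < e := by
      have : (3 : ℝ) < e := by linarith
      exact_mod_cast this
    obtain ⟨p, hp⟩ := (hasSeparated_iff_of_denseRange ha.dense).1 hs
    refine ⟨(n, e, (List.range s).map p), ⟨by dsimp only; omega, ?_⟩, ?_, ?_⟩
    · have : t₂ * 2 ^ n * 2 ^ i < 2 ^ n := by
        have h2i : (0 : ℝ) < 2 ^ i := by positivity
        rw [one_div_pow, lt_div_iff₀ h2i] at ht₂
        calc t₂ * 2 ^ n * 2 ^ i = (t₂ * 2 ^ i) * 2 ^ n := by ring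
          _ < 1 * 2 ^ n := mul_lt_mul_of_pos_right ht₂ h2
          _ = 2 ^ n := one_mul _
      have h3 : (e : ℝ) * 2 ^ i < 2 ^ n :=
        lt_of_le_of_lt (mul_le_mul_of_nonneg_right hle (by positivity)) this
      exact_mod_cast h3
    · intro j hj k hk
      simp only [List.length_map, List.length_range] at hj
      dsimp only
      rw [List.getD_map_range p hj, List.getD_map_range p (hk.trans hj)]
      push_cast
      exact hle.trans_lt (mul_lt_mul_of_pos_right (hp j hj k hk) h2)
    · intro t _
      by_contra! hcon
      refine hs' (hasSeparated_of_forall_lt (x := fun j => a (t.getD j 0)) fun j hj k hk => ?_)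
      have hjk := hcon j k ⟨by simpa using hj, hk⟩
      dsimp only at hjk
      rw [Nat.cast_sub (by omega)] at hjk
      push_cast at hjk
      have : t₁ * 2 ^ n < dist (a (t.getD j 0)) (a (t.getD k 0)) * 2 ^ n := by linarith
      exact lt_of_mul_lt_mul_right this h2.le
  have hcast : ∀ i, (((g i).2.1 / 2 ^ (g i).1 : ℚ) : ℝ) = (g i).2.1 / 2 ^ (g i).1 := fun i => by
    push_cast; rfl
  refine ⟨fun i => (g i).2.1 / 2 ^ (g i).1, fun i => (g i).2.2.length,
    ⟨fun _ => 0, fun i => (g i).2.1, fun i => 2 ^ (g i).1, Computable.const 0,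
      Computable.fst.comp (Computable.snd.comp hg), (Computable.fst.comp hg).two_pow,
      fun i => ⟨by positivity, by push_cast; ring⟩⟩,
    Computable.list_length.comp (Computable.snd.comp (Computable.snd.comp hg)),
    fun i => ?_, ?_, fun i => ?_⟩
  · have : (0 : ℚ) < (g i).2.1 := by exact_mod_cast (hgP i).1.1
    positivity
  · refine squeeze_zero (fun i => by rw [hcast]; positivity) (fun i => ?_)
      (tendsto_pow_atTop_nhds_zero_of_lt_one (r := (1 / 2 : ℝ)) (by norm_num) (by norm_num))
    rw [hcast, one_div_pow, div_le_div_iff₀ (by positivity) (by positivity), one_mul]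
    exact_mod_cast (hgP i).1.2.le
  · obtain ⟨-, hlow, hup⟩ := hgP i
    rw [isLUB_hasSeparated_iff ha.dense, hcast]
    dsimp only
    generalize g i = w at hlow hup ⊢
    obtain ⟨n, e, L⟩ := w
    dsimp only
    have h2 : (0 : ℝ) < 2 ^ n := by positivity
    constructor
    · refine hasSeparated_of_forall_lt (x := fun j => a (L.getD j 0)) fun j hj k hk => ?_
      rw [div_lt_iff₀ h2]
      simpa using hlow j hj k hk
    · intro hsep
      obtain ⟨p, hp⟩ := (hasSeparated_iff_of_denseRange ha.dense).1 hsep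
      choose c hcF hc using fun j => hcov n (a (p j))
      obtain ⟨j, k, ⟨hj, hk⟩, hjk⟩ := hup ((List.range (L.length + 1)).map c)
        ((List.mem_sections_map_range 0).2 ⟨by simp, fun j hj => by
          rw [List.getD_map_range c hj]; exact hcF j⟩)
      dsimp only at hjk hj
      rw [List.getD_map_range c hj, List.getD_map_range c (hk.trans hj)] at hjk
      have hd : dist (a (p j)) (a (p k)) * 2 ^ n ≤ dist (a (c j)) (a (c k)) * 2 ^ n + 2 := by
        have h1 : (1 / 2 : ℝ) ^ n * 2 ^ n = 1 := by rw [← mul_pow]; norm_num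
        have h3 : dist (a (p j)) (a (p k)) ≤
            dist (a (c j)) (a (c k)) + 2 * (1 / 2 : ℝ) ^ n := by
          have h4 := dist_triangle4_left (a (c j)) (a (c k)) (a (p j)) (a (p k))
          linarith [hc j, hc k]
        have h5 := mul_le_mul_of_nonneg_right h3 h2.le
        linarith [add_mul (dist (a (c j)) (a (c k))) (2 * (1 / 2 : ℝ) ^ n) (2 ^ n)]
      have hpe := (div_lt_iff₀ h2).1 (hp j hj k hk)
      have he2 : 2 ≤ e := by
        by_contra! hlt
        rw [Nat.sub_eq_zero_of_le hlt.le, Nat.cast_zero] at hjk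
        exact absurd hjk (not_lt.2 (by positivity))
      rw [Nat.cast_sub he2] at hjk
      push_cast at hjk
      linarith

/-- A maximal `ε`-separated list of designated points is an `ε`-net, and it can be found because its
length is known. -/
theorem hasComputableNets_of_separation (ha : IsComputableMetricSpace a) {ε : ℕ → ℚ} {s : ℕ → ℕ}
    (hε : ComputableRat ε) (hs : Computable s) (hpos : ∀ i, 0 < ε i)
    (hlim : Tendsto (fun i => (ε i : ℝ)) atTop (𝓝 0))
    (hsep : ∀ i, IsLUB {m : ℕ | HasSeparated X (ε i) m} (s i)) : HasComputableNets a := by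
  obtain ⟨σ, u, v, -, hu, hv, huv⟩ := hε
  have hv0 : ∀ i, (0 : ℝ) < v i := fun i => by exact_mod_cast Nat.pos_of_ne_zero (huv i).1
  have hεuv : ∀ i, (ε i : ℝ) = u i / v i := fun i => by
    have h : |ε i| = u i / v i := by
      rw [(huv i).2, abs_div, abs_mul, abs_neg_one_pow, one_mul, Nat.abs_cast, Nat.abs_cast]
    rw [abs_of_pos (hpos i)] at h
    rw [h]; push_cast; rfl
  let P : ℕ × ℕ × List ℕ → Prop := fun z => (z.2.2.length = s z.2.1 ∧
    u z.2.1 * 2 ^ z.1 < v z.2.1) ∧ ∀ j < z.2.2.length, ∀ k < j,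
      (u z.2.1 : ℝ) < dist (a (z.2.2.getD j 0)) (a (z.2.2.getD k 0)) * v z.2.1
  have hi : Computable fun z : ℕ × ℕ × List ℕ => z.2.1 := Computable.fst.comp Computable.snd
  have hL : Computable fun z : ℕ × ℕ × List ℕ => z.2.2 := Computable.snd.comp Computable.snd
  have hlen : Computable fun z : ℕ × ℕ × List ℕ => z.2.2.length := Computable.list_length.comp hL
  have hP : REPred P := by
    refine ((REPred.nat_eq hlen (hs.comp hi)).and (REPred.nat_lt
      ((hu.comp hi).nat_mul Computable.fst.two_pow) (hv.comp hi))).and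
      (REPred.forall_lt (REPred.forall_lt
        (p := fun z : ((ℕ × ℕ × List ℕ) × ℕ) × ℕ => (u z.1.1.2.1 : ℝ) <
          dist (a (z.1.1.2.2.getD z.1.2 0)) (a (z.1.1.2.2.getD z.2 0)) * v z.1.1.2.1)
        ?_ Computable.snd) hlen)
    have h11 : Computable fun z : ((ℕ × ℕ × List ℕ) × ℕ) × ℕ => z.1.1 :=
      Computable.fst.comp Computable.fst
    exact ha.rePred_lt_dist_mul
      (Computable.list_getD (hL.comp h11) (Computable.snd.comp Computable.fst) 0)
      (Computable.list_getD (hL.comp h11) Computable.snd 0)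
      (hu.comp (hi.comp h11)) (hv.comp (hi.comp h11))
  obtain ⟨g, hg, hgP⟩ := hP.exists_computable_choice fun k => by
    obtain ⟨i, hik⟩ := (hlim.eventually_lt_const
      (show (0 : ℝ) < (1 / 2) ^ k by positivity)).exists
    obtain ⟨p, hp⟩ := (hasSeparated_iff_of_denseRange ha.dense).1
      ((isLUB_hasSeparated_iff ha.dense).1 (hsep i)).1
    refine ⟨(i, (List.range (s i)).map p), ⟨by simp, ?_⟩, fun j hj k hk => ?_⟩
    · rw [hεuv, one_div_pow, div_lt_div_iff₀ (hv0 i) (by positivity), one_mul] at hik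
      exact_mod_cast hik
    · simp only [List.length_map, List.length_range] at hj
      dsimp only
      rw [List.getD_map_range p hj, List.getD_map_range p (hk.trans hj), ← div_lt_iff₀ (hv0 i),
        ← hεuv]
      exact hp j hj k hk
  refine ⟨fun k => (g k).2, Computable.snd.comp hg, fun k x => ?_⟩
  obtain ⟨⟨hlens, hsmall⟩, hlow⟩ := hgP k
  dsimp only at hlens hsmall hlow
  set i := (g k).1
  set L := (g k).2
  have hεk : (ε i : ℝ) < (1 / 2) ^ k := by
    rw [hεuv, one_div_pow, div_lt_div_iff₀ (hv0 i) (by positivity), one_mul]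
    exact_mod_cast hsmall
  by_contra! hcon
  -- Otherwise the point `x` could be added to the separated list.
  refine ((isLUB_hasSeparated_iff ha.dense).1 (hsep i)).2 (hasSeparated_of_forall_lt
    (x := fun j => if j < L.length then a (L.getD j 0) else x) fun j hj l hl => ?_)
  have hlL : l < L.length := by omega
  simp only [hlL, if_true]
  split_ifs with hjL
  · rw [hεuv, div_lt_iff₀ (hv0 i)]
    exact hlow j hjL l hl
  · rw [dist_comm]
    refine hεk.trans_le (hcon _ ?_)
    rw [List.getD_eq_getElem _ _ hlL]
    exact List.getElem_mem hlL

end IsComputableMetricSpace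

/-! ### The equivalence -/

theorem mainTheorem5 {X : Type*} [MetricSpace X] (a : ℕ → X) (ha : IsComputablePolishSpace a) :
    ha.toIsComputableMetricSpace.represented.ComputablyCompact ↔
      ∃ (ε : ℕ → ℚ) (s : ℕ → ℕ), ComputableRat ε ∧ Computable s ∧ (∀ i, 0 < ε i) ∧
        Tendsto (fun i => (ε i : ℝ)) atTop (𝓝 0) ∧
        ∀ i, IsLUB {m : ℕ | ∃ x : Fin m → X, ∀ j k, j ≠ k → (ε i : ℝ) < dist (x j) (x k)}
          (s i) := by
  have ha' := ha.toIsComputableMetricSpace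
  have := ha.complete
  constructor
  · intro h
    exact ha'.exists_separation_of_hasComputableNets (ha'.hasComputableNets_of_computablyCompact h)
  · rintro ⟨ε, s, hε, hs, hpos, hlim, hsep⟩
    exact ha'.computablyCompact_of_hasComputableNets
      (ha'.hasComputableNets_of_separation hε hs hpos hlim hsep)
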